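/- Conventions. Let $\mathbb K$ be a field. An \emph{extremal epimorphism}, written $x\twoheadrightarrow z$, is an epimorphism that does not factor through a proper subobject of $z$. A category $\mathcal A$ is called \emph{regular} if it has a terminal object; every morphism has an image; the pullback of $x\to z\leftarrow y$ exists whenever this cospan can be completed to a commutative square, and also whenever $x\twoheadrightarrow z$ is an extremal epimorphism; and extremal epimorphisms are stable under pullback. (Finite completeness is not required.) A \emph{degree function} $\delta$ on $\mathcal A$ assigns to every extremal epimorphism $e$ an element $\delta(e)\in\mathbb K$ such that $\delta(\mathrm{Id}_x)=1$, $\delta(e'e)=\delta(e')\delta(e)$, and $\delta(e')=\delta(e)$ whenever $e'$ is a pullback of $e$. The category $\mathcal T^0(\mathcal A,\delta)$ has an object $[x]$ for every object $x$ of $\mathcal A$; morphisms $[x]\to[y]$ are formal $\mathbb K$-linear combinations of relations $\langle r\rangle$, where a relation $r$ between $x$ and $y$ is a jointly monic pair $x\leftarrow r\to y$ up to isomorphism, i.e. a subobject $r\subset x\times y$ (there are no relations if $x\times y$ does not exist). Composition is bilinear, with $\langle s\rangle\circ\langle r\rangle=\delta(e)\langle \mathrm{im}(r\times_y s\to x\times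 z)\rangle$, where $e:r\times_y s\twoheadrightarrow \mathrm{im}(r\times_y s\to x\times z)$, if $r\times_y s$ exists, and $\langle s\rangle\circ\langle r\rangle=0$ otherwise. The functor $\Gamma_{\mathcal A}:\mathcal A\to\mathcal T^0(\mathcal A,\delta)$ sends $x$ to $[x]$ and a morphism to its graph. The Deligne--Knop category $\mathcal T(\mathcal A,\delta)$ is the additive Karoubi envelope of $\mathcal T^0(\mathcal A,\delta)$. A functor $F:\mathcal A\to\mathcal A'$ between regular categories with degree functions $\delta,\delta'$ \emph{preserves the degree functions} if it preserves extremal epimorphisms and $\delta'(F(e))=\delta(e)$ for each of them. It \emph{preserves pullbacks} if it sends pullback squares to pullback squares and, moreover, a cospan in $\mathcal A$ has a pullback whenever its image under $F$ has one (this last condition is void if all pullbacks exist in $\mathcal A$). If $F$ preserves the degree functions and pullbacks, it induces a functor $\overline F:\mathcal T^0(\mathcal A,\delta)\to\mathcal T^0(\mathcal A',\delta')$, $[x]\mapsto[F(x)]$, $\langle r\rangle\mapsto\langle F(r)\rangle$, which extends to the additive Karoubi envelopes, $\overline F:\mathcal T(\mathcal A,\delta)\to\mathcal T(\mathcal A',\delta')$.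 Proposition. Let $\mathcal A,\mathcal A'$ be regular categories with degree functions $\delta,\delta'$ with values in $\mathbb K$. Let $F:\mathcal A\to\mathcal A'$ and $G:\mathcal A'\to\mathcal A$ be functors with $G$ left adjoint to $F$, such that both preserve the degree functions and $G$ preserves pullbacks (then so does $F$). Let $\eta:\mathrm{Id}_{\mathcal A'}\Rightarrow FG$ and $\varepsilon:GF\Rightarrow\mathrm{Id}_{\mathcal A}$ be the unit and the counit, and assume that for all $f:x\to y$ in $\mathcal A$ and $f':x'\to y'$ in $\mathcal A'$ the naturality squares $$\begin{array}{ccc} x' & \xrightarrow{\ \eta_{x'}\ } & FG(x')\\ {\scriptstyle f'}\downarrow & & \downarrow{\scriptstyle FG(f')}\\ y' & \xrightarrow{\ \eta_{y'}\ } & FG(y')\end{array}\qquad\qquad \begin{array}{ccc} GF(x) & \xrightarrow{\ \varepsilon_{x}\ } & x\\ {\scriptstyle GF(f)}\downarrow & & \downarrow{\scriptstyle f}\\ GF(y) & \xrightarrow{\ \varepsilon_{y}\ } & y\end{array}$$ are Cartesian. Then $\overline G$ is left adjoint to $\overline F$, both as functors between $\mathcal T^0(\mathcal A',\delta')$ and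 $\mathcal T^0(\mathcal A,\delta)$ and as functors between $\mathcal T(\mathcal A',\delta')$ and $\mathcal T(\mathcal A,\delta)$; the unit is given on the objects $[x']$ by $\Gamma_{\mathcal A'}(\eta_{x'})$ and the counit on the objects $[x]$ by $\Gamma_{\mathcal A}(\varepsilon_x)$ (for $\mathcal T$, up to the canonical identification of $\overline F$ and $\overline G$ on $\mathcal T$, restricted along $\mathcal T^0\to\mathcal T$, with $\overline F$ and $\overline G$ on $\mathcal T^0$). -/

import Mathlib

open CategoryTheory CategoryTheory.Limits

universe w v u v' u'

noncomputable section

namespace DeligneKnop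

attribute [local simp] prod.lift_fst prod.lift_snd prod.lift_fst_assoc prod.lift_snd_assoc
  pullback.lift_fst pullback.lift_snd pullback.lift_fst_assoc pullback.lift_snd_assoc

/-- Regular categories in the sense of Knop. Here, as in Knop's construction, `x ↠ z` stands for an
extremal epimorphism (an epimorphism that does not factor through a proper subobject of `z`).
No finite completeness is assumed: a cospan need not have a pullback unless it can be completed to
a commutative square or one of its legs is an extremal epimorphism. -/
class KnopRegular (A : Type u) [Category.{v} A] : Prop where
  hasTerminal : HasTerminal A
  hasImages : HasImages A
  hasPullback_of_comm {w x y z : A} (f : x ⟶ z) (g : y ⟶ z) (p : w ⟶ x) (q : w ⟶ y) :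
    p ≫ f = q ≫ g → HasPullback f g
  hasPullback_of_epi {x y z : A} (f : x ⟶ z) (g : y ⟶ z) [ExtremalEpi f] : HasPullback f g
  epi_of_isPullback {p x y z : A} {f' : p ⟶ y} {g' : p ⟶ x} {f : x ⟶ z} {g : y ⟶ z}
    [ExtremalEpi f] : IsPullback g' f' f g → ExtremalEpi f'

attribute [instance] KnopRegular.hasTerminal KnopRegular.hasImages

/-- A degree function with values in `K`: it is defined on (extremal) epimorphisms, multiplicative
and invariant under pullback. -/
structure DegreeFunction (A : Type u) [Category.{v} A] (K : Type w) [Field K] where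
  deg : ∀ {x y : A} (e : x ⟶ y) [ExtremalEpi e], K
  deg_id : ∀ x : A, deg (𝟙 x) = 1
  deg_comp : ∀ {x y z : A} (e : x ⟶ y) (e' : y ⟶ z) [ExtremalEpi e] [ExtremalEpi e']
    [ExtremalEpi (e ≫ e')], deg (e ≫ e') = deg e' * deg e
  deg_pullback : ∀ {p x y z : A} {e' : p ⟶ y} {g' : p ⟶ x} {e : x ⟶ z} {g : y ⟶ z}
    [ExtremalEpi e] [ExtremalEpi e'], IsPullback g' e' e g → deg e' = deg e

/-! ### Factorisations in regular categories -/

instance extremalEpi_of_iso {A : Type u} [Category.{v} A] {x y : A} (f : x ⟶ y) [IsIso f] :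
    ExtremalEpi f where
  isIso p i fac _ := by
    refine ⟨inv f ≫ p, ?_, by simp [fac]⟩
    rw [← cancel_mono i, Category.assoc, Category.assoc, fac]; simp

theorem DegreeFunction.deg_iso {A : Type u} [Category.{v} A] {K : Type w} [Field K] (δ : DegreeFunction A K) {x y : A}
    (f : x ⟶ y) [IsIso f] : δ.deg f = 1 := by
  rw [← δ.deg_id y]
  exact δ.deg_pullback (IsPullback.of_vert_isIso ⟨by simp⟩ : IsPullback f f (𝟙 y) (𝟙 y))

section Basic

variable {A : Type u} [Category.{v} A] [KnopRegular A]

theorem hasBinaryProduct_of_span {w x y : A} (p : w ⟶ x) (q : w ⟶ y) : HasBinaryProduct x y := by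
  have : HasPullback (terminal.from x) (terminal.from y) :=
    KnopRegular.hasPullback_of_comm _ _ p q (by subsingleton)
  exact ⟨⟨⟨_, isProductOfIsTerminalIsPullback _ _ _ _ terminalIsTerminal
    (pullbackIsPullback (terminal.from x) (terminal.from y))⟩⟩⟩

theorem extremalEpi_of_isIso {x y : A} (f : x ⟶ y)
    (h : ∀ ⦃z : A⦄ (p : x ⟶ z) (i : z ⟶ y), p ≫ i = f → Mono i → IsIso i) : ExtremalEpi f where
  left_cancellation {t} a b hab := by
    have := hasBinaryProduct_of_span (𝟙 t) (𝟙 t)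
    have hc : f ≫ prod.lift a b = (f ≫ a) ≫ prod.lift (𝟙 t) (𝟙 t) := by
      apply prod.hom_ext <;> simp [hab]
    have := KnopRegular.hasPullback_of_comm _ _ _ _ hc
    have : Mono (prod.lift (𝟙 t) (𝟙 t)) :=
      ⟨fun u v huv => by simpa using congrArg (· ≫ prod.fst) huv⟩
    have := h (pullback.lift _ _ hc) (pullback.fst _ _) (by simp) inferInstance
    have h1 := congrArg (· ≫ prod.fst)
      (pullback.condition (f := prod.lift a b) (g := prod.lift (𝟙 t) (𝟙 t)))
    have h2 := congrArg (· ≫ prod.snd)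
      (pullback.condition (f := prod.lift a b) (g := prod.lift (𝟙 t) (𝟙 t)))
    simp only [Category.assoc, prod.lift_fst, prod.lift_snd, Category.comp_id] at h1 h2
    rw [← cancel_epi (pullback.fst (prod.lift a b) (prod.lift (𝟙 t) (𝟙 t))), h1, h2]
  isIso p i fac _ := h p i fac inferInstance

instance extremalEpi_factorThruImage {x y : A} (f : x ⟶ y) :
    ExtremalEpi (factorThruImage f) := by
  refine extremalEpi_of_isIso _ fun z p i hp hi => ?_
  let M : MonoFactorisation f := ⟨z, i ≫ image.ι f, p, by rw [← Category.assoc, hp, image.fac]⟩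
  refine ⟨image.lift M, ?_, ?_⟩
  · rw [← cancel_mono (i ≫ image.ι f)]
    have := image.lift_fac M
    simp only [Category.assoc, Category.id_comp, this, M]
  · rw [← cancel_mono (image.ι f)]
    have := image.lift_fac M
    simpa only [Category.assoc, Category.id_comp, M] using this

/-- Extremal epimorphisms are orthogonal to monomorphisms. -/
theorem exists_diag {w v a b : A} (e : w ⟶ v) [ExtremalEpi e] (m : a ⟶ b) [Mono m]
    (s : w ⟶ a) (t : v ⟶ b) (h : e ≫ t = s ≫ m) : ∃ l : v ⟶ a, l ≫ m = t := by
  have := KnopRegular.hasPullback_of_comm _ _ _ _ h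
  have := ExtremalEpi.isIso e (pullback.lift _ _ h) (pullback.fst t m) (by simp)
  exact ⟨inv (pullback.fst t m) ≫ pullback.snd t m, by simp [← pullback.condition]⟩

instance extremalEpi_comp {x y z : A} (e : x ⟶ y) (e' : y ⟶ z) [ExtremalEpi e] [ExtremalEpi e'] :
    ExtremalEpi (e ≫ e') := by
  refine extremalEpi_of_isIso _ fun t p i hp hi => ?_
  obtain ⟨l, hl⟩ := exists_diag e i p e' hp.symm
  exact ExtremalEpi.isIso e' l i hl

end Basic

/-! ### Relations -/

/-- A relation between `x` and `y`, presented by a jointly monic span `x ← apex → y`, that is by a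
monomorphism into `x × y` whenever this product exists (in a regular category it does exist as soon
as there is any span at all). -/
structure RelSpan {A : Type u} [Category.{v} A] (x y : A) where
  apex : A
  fst : apex ⟶ x
  snd : apex ⟶ y
  ext : ∀ ⦃w : A⦄ (a b : w ⟶ apex), a ≫ fst = b ≫ fst → a ≫ snd = b ≫ snd → a = b

/-- Two jointly monic spans present the same relation when they are isomorphic. -/
instance RelSpan.setoid {A : Type u} [Category.{v} A] (x y : A) : Setoid (RelSpan x y) where
  r r s := ∃ e : r.apex ≅ s.apex, e.hom ≫ s.fst = r.fst ∧ e.hom ≫ s.snd = r.snd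
  iseqv :=
    { refl := fun r => ⟨Iso.refl _, by simp, by simp⟩
      symm := by
        rintro r s ⟨e, h1, h2⟩
        exact ⟨e.symm, by simp [← h1], by simp [← h2]⟩
      trans := by
        rintro r s t ⟨e, h1, h2⟩ ⟨e', h3, h4⟩
        exact ⟨e ≪≫ e', by simp [h1, h3], by simp [h2, h4]⟩ }

/-- Relations `r ⊆ x × y`. -/
def Relation {A : Type u} [Category.{v} A] (x y : A) : Type (max u v) :=
  Quotient (RelSpan.setoid x y)

/-- The relation presented by a jointly monic span. -/
def RelSpan.toRelation {A : Type u} [Category.{v} A] {x y : A} (r : RelSpan x y) : Relation x y :=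
  Quotient.mk _ r

theorem RelSpan.toRelation_eq {A : Type u} [Category.{v} A] {x y : A} {r s : RelSpan x y}
    (e : r.apex ≅ s.apex) (h1 : e.hom ≫ s.fst = r.fst) (h2 : e.hom ≫ s.snd = r.snd) :
    r.toRelation = s.toRelation :=
  Quotient.sound ⟨e, h1, h2⟩

theorem RelSpan.mono_lift {A : Type u} [Category.{v} A] {x y : A} [HasBinaryProduct x y]
    (r : RelSpan x y) : Mono (prod.lift r.fst r.snd) :=
  ⟨fun a b h => r.ext a b (by simpa using congrArg (· ≫ prod.fst) h)
    (by simpa using congrArg (· ≫ prod.snd) h)⟩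

/-- The relation given by a subobject of the product. -/
def RelSpan.ofSubobject {A : Type u} [Category.{v} A] {x y : A} [HasBinaryProduct x y]
    (S : Subobject (x ⨯ y)) : RelSpan x y :=
  ⟨(S : A), S.arrow ≫ prod.fst, S.arrow ≫ prod.snd,
    fun _ a b h1 h2 => by rw [← cancel_mono S.arrow]; apply prod.hom_ext <;> simpa⟩

/-- Relations are the subobjects of the product, when the latter exists. -/
def relationEquivSubobject {A : Type u} [Category.{v} A] (x y : A) [HasBinaryProduct x y] :
    Relation x y ≃ Subobject (x ⨯ y) where
  toFun := Quotient.lift (fun r : RelSpan x y =>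
      haveI := r.mono_lift
      Subobject.mk (prod.lift r.fst r.snd)) (by
    rintro r s ⟨e, h1, h2⟩
    have := r.mono_lift
    have := s.mono_lift
    exact Subobject.mk_eq_mk_of_comm _ _ e (by ext <;> simp [h1, h2]))
  invFun S := (RelSpan.ofSubobject S).toRelation
  left_inv := by
    rintro ⟨r⟩
    have : Mono (prod.lift r.fst r.snd) := r.mono_lift
    have h := Subobject.underlyingIso_hom_comp_eq_mk (prod.lift r.fst r.snd)
    have h1 : (Subobject.underlyingIso (prod.lift r.fst r.snd)).hom ≫ r.fst =
        (Subobject.mk (prod.lift r.fst r.snd)).arrow ≫ prod.fst := by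
      rw [← h, Category.assoc, prod.lift_fst]
    have h2 : (Subobject.underlyingIso (prod.lift r.fst r.snd)).hom ≫ r.snd =
        (Subobject.mk (prod.lift r.fst r.snd)).arrow ≫ prod.snd := by
      rw [← h, Category.assoc, prod.lift_snd]
    exact Quotient.sound ⟨Subobject.underlyingIso (prod.lift r.fst r.snd), h1, h2⟩
  right_inv S := by
    have := (RelSpan.ofSubobject S).mono_lift
    refine Eq.trans ?_ (Subobject.mk_arrow S)
    exact Subobject.mk_eq_mk_of_comm _ _ (Iso.refl _)
      (by apply prod.hom_ext <;> simp [RelSpan.ofSubobject])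

/-! ### Images of spans, composition of relations -/

section Comp

variable {A : Type u} [Category.{v} A] [KnopRegular A]

/-- The image of `w → x × z`, as a relation between `x` and `z`. -/
def imageSpan {w x z : A} (p : w ⟶ x) (q : w ⟶ z) : RelSpan x z :=
  haveI := hasBinaryProduct_of_span p q
  { apex := image (prod.lift p q)
    fst := image.ι (prod.lift p q) ≫ prod.fst
    snd := image.ι (prod.lift p q) ≫ prod.snd
    ext := fun _ a b h1 h2 => by
      rw [← cancel_mono (image.ι (prod.lift p q))]
      apply prod.hom_ext <;> simpa }

/-- The canonical epimorphism from `w` onto the image of `w → x × z`. -/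
def toImageSpan {w x z : A} (p : w ⟶ x) (q : w ⟶ z) : w ⟶ (imageSpan p q).apex :=
  haveI := hasBinaryProduct_of_span p q
  factorThruImage (prod.lift p q)

instance {w x z : A} (p : w ⟶ x) (q : w ⟶ z) : ExtremalEpi (toImageSpan p q) := by
  unfold toImageSpan; exact extremalEpi_factorThruImage _

@[simp]
theorem toImageSpan_fst {w x z : A} (p : w ⟶ x) (q : w ⟶ z) :
    toImageSpan p q ≫ (imageSpan p q).fst = p := by
  have := hasBinaryProduct_of_span p q
  simp [toImageSpan, imageSpan]

@[simp]
theorem toImageSpan_snd {w x z : A} (p : w ⟶ x) (q : w ⟶ z) :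
    toImageSpan p q ≫ (imageSpan p q).snd = q := by
  have := hasBinaryProduct_of_span p q
  simp [toImageSpan, imageSpan]

variable {K : Type w} [Field K] (δ : DegreeFunction A K)

/-- `δ(e) ⟨im⟩`, where `e : w ↠ im` and `im` is the image of `w → x × z`. -/
def spanMor {w x z : A} (p : w ⟶ x) (q : w ⟶ z) : Relation x z →₀ K :=
  Finsupp.single (imageSpan p q).toRelation (δ.deg (toImageSpan p q))

open Classical in
/-- The composite of two relations: `δ(e) ⟨im (r ×_y s → x × z)⟩`, where
`e : r ×_y s ↠ im (r ×_y s → x × z)`, if `r ×_y s` exists, and `0` otherwise. -/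
def compSpan {x y z : A} (r : RelSpan x y) (s : RelSpan y z) : Relation x z →₀ K :=
  if _ : HasPullback r.snd s.fst then
    spanMor δ (pullback.fst r.snd s.fst ≫ r.fst) (pullback.snd r.snd s.fst ≫ s.snd)
  else 0

theorem exists_diag_span {w v x y : A} (r : RelSpan x y) (e : w ⟶ v) [ExtremalEpi e]
    (a : w ⟶ r.apex) (p : v ⟶ x) (q : v ⟶ y) (h1 : e ≫ p = a ≫ r.fst) (h2 : e ≫ q = a ≫ r.snd) :
    ∃ l : v ⟶ r.apex, l ≫ r.fst = p ∧ l ≫ r.snd = q := by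
  have := hasBinaryProduct_of_span p q
  have : Mono (prod.lift r.fst r.snd) := r.mono_lift
  obtain ⟨l, hl⟩ := exists_diag e (prod.lift r.fst r.snd) a (prod.lift p q)
    (by ext <;> simp [h1, h2])
  exact ⟨l, by simpa using congrArg (· ≫ prod.fst) hl, by simpa using congrArg (· ≫ prod.snd) hl⟩

/-- The factorisation of a span into an epimorphism and a relation is unique. -/
theorem exists_iso_of_fac {w x y : A} (r s : RelSpan x y) (e : w ⟶ r.apex) (e' : w ⟶ s.apex)
    [ExtremalEpi e] [ExtremalEpi e'] (h1 : e ≫ r.fst = e' ≫ s.fst)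
    (h2 : e ≫ r.snd = e' ≫ s.snd) :
    ∃ i : r.apex ≅ s.apex, e ≫ i.hom = e' ∧ i.hom ≫ s.fst = r.fst ∧ i.hom ≫ s.snd = r.snd := by
  obtain ⟨l, l1, l2⟩ := exists_diag_span s e e' r.fst r.snd h1 h2
  obtain ⟨k, k1, k2⟩ := exists_diag_span r e' e s.fst s.snd h1.symm h2.symm
  refine ⟨⟨l, k, r.ext _ _ ?_ ?_, s.ext _ _ ?_ ?_⟩, s.ext _ _ ?_ ?_, l1, l2⟩ <;>
    simp [l1, l2, k1, k2, h1, h2]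

theorem spanMor_eq {w x y : A} (r : RelSpan x y) (e : w ⟶ r.apex) [ExtremalEpi e]
    {p : w ⟶ x} {q : w ⟶ y} (h1 : e ≫ r.fst = p) (h2 : e ≫ r.snd = q) :
    spanMor δ p q = Finsupp.single r.toRelation (δ.deg e) := by
  obtain ⟨i, i1, i2, i3⟩ := exists_iso_of_fac (imageSpan p q) r (toImageSpan p q) e
    (by simp [h1]) (by simp [h2])
  have h : δ.deg e = δ.deg (toImageSpan p q) := by
    subst i1
    rw [δ.deg_comp, δ.deg_iso, one_mul]
  rw [spanMor, RelSpan.toRelation_eq i i2 i3, h]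

theorem spanMor_self {x y : A} (r : RelSpan x y) :
    spanMor δ r.fst r.snd = Finsupp.single r.toRelation 1 := by
  rw [spanMor_eq δ r (𝟙 _) (by simp) (by simp), δ.deg_id]

theorem spanMor_epi_comp {w v x y : A} (e : w ⟶ v) [ExtremalEpi e] (p : v ⟶ x) (q : v ⟶ y) :
    spanMor δ (e ≫ p) (e ≫ q) = δ.deg e • spanMor δ p q := by
  rw [spanMor_eq δ (imageSpan p q) (e ≫ toImageSpan p q) (by simp) (by simp), spanMor,
    δ.deg_comp, Finsupp.smul_single, smul_eq_mul, mul_comm]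

theorem spanMor_iso_comp {w v x y : A} (e : w ⟶ v) [IsIso e] (p : v ⟶ x) (q : v ⟶ y) :
    spanMor δ (e ≫ p) (e ≫ q) = spanMor δ p q := by
  rw [spanMor_epi_comp, δ.deg_iso, one_smul]

theorem compSpan_of_isPullback {x y z t : A} (r : RelSpan x y) (s : RelSpan y z)
    {a : t ⟶ r.apex} {b : t ⟶ s.apex} (h : IsPullback a b r.snd s.fst) :
    compSpan δ r s = spanMor δ (a ≫ r.fst) (b ≫ s.snd) := by
  have hp : HasPullback r.snd s.fst := h.hasPullback
  rw [compSpan, dif_pos hp, ← spanMor_iso_comp δ h.isoPullback.hom]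
  simp

theorem compSpan_of_not {x y z : A} (r : RelSpan x y) (s : RelSpan y z)
    (h : ¬ HasPullback r.snd s.fst) : compSpan δ r s = 0 := by
  rw [compSpan, dif_neg h]

theorem compSpan_congr {x y z : A} (r r' : RelSpan x y) (s s' : RelSpan y z)
    (hr : r ≈ r') (hs : s ≈ s') : compSpan δ r s = compSpan δ r' s' := by
  obtain ⟨e, e1, e2⟩ := hr
  obtain ⟨i, i1, i2⟩ := hs
  by_cases h : HasPullback r.snd s.fst
  · have hp : IsPullback (pullback.fst r.snd s.fst ≫ e.hom) (pullback.snd r.snd s.fst ≫ i.hom)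
        r'.snd s'.fst :=
      (IsPullback.of_hasPullback r.snd s.fst).of_iso (Iso.refl _) e i (Iso.refl _)
        (by simp) (by simp) (by simp [e2]) (by simp [i1])
    rw [compSpan_of_isPullback δ r s (IsPullback.of_hasPullback _ _),
      compSpan_of_isPullback δ r' s' hp]
    simp [e1, i2]
  · rw [compSpan_of_not δ r s h, compSpan_of_not]
    intro h'
    refine h (KnopRegular.hasPullback_of_comm _ _ (pullback.fst r'.snd s'.fst ≫ e.inv)
      (pullback.snd r'.snd s'.fst ≫ i.inv) ?_)
    simp [← e2, ← i1, pullback.condition]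

/-- The composition of relations, with values in formal linear combinations of relations. -/
def compRel {x y z : A} : Relation x y → Relation y z → (Relation x z →₀ K) :=
  Quotient.lift₂ (compSpan δ) (fun r s r' s' hr hs => compSpan_congr δ r r' s s' hr hs)

/-- The bilinear extension of `compRel`. -/
def compLin (x y z : A) :
    (Relation x y →₀ K) →ₗ[K] (Relation y z →₀ K) →ₗ[K] (Relation x z →₀ K) :=
  Finsupp.linearCombination K (fun r => Finsupp.linearCombination K (fun s => compRel δ r s))

theorem compLin_single {x y z : A} (r : RelSpan x y) (s : RelSpan y z) (a b : K) :
    compLin δ x y z (Finsupp.single r.toRelation a) (Finsupp.single s.toRelation b) =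
      (a * b) • compSpan δ r s := by
  rw [compLin, Finsupp.linearCombination_single, LinearMap.smul_apply,
    Finsupp.linearCombination_single, smul_smul]
  rfl

/-- The composite of two arbitrary spans is computed by their pullback. -/
theorem compLin_spanMor {x y z v w t : A} (p : v ⟶ x) (q : v ⟶ y) (p' : w ⟶ y) (q' : w ⟶ z)
    {a : t ⟶ v} {b : t ⟶ w} (h : IsPullback a b q p') :
    compLin δ x y z (spanMor δ p q) (spanMor δ p' q') = spanMor δ (a ≫ p) (b ≫ q') := by
  obtain ⟨r, e, he, rfl, rfl⟩ : ∃ (r : RelSpan x y) (e : v ⟶ r.apex) (_ : ExtremalEpi e),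
    e ≫ r.fst = p ∧ e ≫ r.snd = q := ⟨imageSpan p q, toImageSpan p q, inferInstance, by simp⟩
  obtain ⟨s, e', he', rfl, rfl⟩ : ∃ (s : RelSpan y z) (e : w ⟶ s.apex) (_ : ExtremalEpi e),
    e ≫ s.fst = p' ∧ e ≫ s.snd = q' := ⟨imageSpan p' q', toImageSpan p' q', inferInstance, by simp⟩
  have hw := h.w
  have : HasPullback r.snd s.fst :=
    KnopRegular.hasPullback_of_comm _ _ (a ≫ e) (b ≫ e') (by simp [hw])
  have : HasPullback r.snd (e' ≫ s.fst) :=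
    KnopRegular.hasPullback_of_comm _ _ (a ≫ e) b (by simp [hw])
  have S1 := IsPullback.of_hasPullback r.snd s.fst
  have SM := IsPullback.of_hasPullback r.snd (e' ≫ s.fst)
  obtain ⟨c1, h1, h2⟩ : ∃ c1, c1 ≫ pullback.fst r.snd (e' ≫ s.fst) = a ≫ e ∧
      c1 ≫ pullback.snd r.snd (e' ≫ s.fst) = b :=
    ⟨pullback.lift (a ≫ e) b (by simp [hw]), by simp, by simp⟩
  obtain ⟨c2, h3, h4⟩ : ∃ c2, c2 ≫ pullback.fst r.snd s.fst = pullback.fst r.snd (e' ≫ s.fst) ∧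
      c2 ≫ pullback.snd r.snd s.fst = pullback.snd r.snd (e' ≫ s.fst) ≫ e' :=
    ⟨pullback.lift (pullback.fst r.snd (e' ≫ s.fst)) (pullback.snd r.snd (e' ≫ s.fst) ≫ e')
      (by simp [pullback.condition]), by simp, by simp⟩
  have T1 : IsPullback c1 a (pullback.fst r.snd (e' ≫ s.fst)) e :=
    IsPullback.of_right (by rw [h2]; exact h.flip) h1 SM.flip
  have T2 : IsPullback c2 (pullback.snd r.snd (e' ≫ s.fst)) (pullback.snd r.snd s.fst) e' :=
    IsPullback.of_right (by rw [h3]; exact SM) h4 S1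
  have := KnopRegular.epi_of_isPullback T1.flip
  have := KnopRegular.epi_of_isPullback T2.flip
  have e1 : a ≫ e ≫ r.fst = c1 ≫ c2 ≫ pullback.fst r.snd s.fst ≫ r.fst := by
    rw [reassoc_of% h3, reassoc_of% h1]
  have e2 : b ≫ e' ≫ s.snd = c1 ≫ c2 ≫ pullback.snd r.snd s.fst ≫ s.snd := by
    rw [reassoc_of% h4, reassoc_of% h2]
  rw [spanMor_eq δ r e rfl rfl, spanMor_eq δ s e' rfl rfl, compLin_single,
    compSpan_of_isPullback δ r s S1, e1, e2, spanMor_epi_comp, spanMor_epi_comp, smul_smul,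
    δ.deg_pullback T1.flip, δ.deg_pullback T2.flip]

theorem compLin_spanMor_of_not {x y z v w : A} (p : v ⟶ x) (q : v ⟶ y) (p' : w ⟶ y) (q' : w ⟶ z)
    (h : ¬ HasPullback q p') :
    compLin δ x y z (spanMor δ p q) (spanMor δ p' q') = 0 := by
  obtain ⟨r, e, he, rfl, rfl⟩ : ∃ (r : RelSpan x y) (e : v ⟶ r.apex) (_ : ExtremalEpi e),
    e ≫ r.fst = p ∧ e ≫ r.snd = q := ⟨imageSpan p q, toImageSpan p q, inferInstance, by simp⟩
  obtain ⟨s, e', he', rfl, rfl⟩ : ∃ (s : RelSpan y z) (e : w ⟶ s.apex) (_ : ExtremalEpi e),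
    e ≫ s.fst = p' ∧ e ≫ s.snd = q' := ⟨imageSpan p' q', toImageSpan p' q', inferInstance, by simp⟩
  rw [spanMor_eq δ r e rfl rfl, spanMor_eq δ s e' rfl rfl, compLin_single, compSpan_of_not,
    smul_zero]
  intro h'
  apply h
  have : HasPullback e (pullback.fst r.snd s.fst) := KnopRegular.hasPullback_of_epi _ _
  have : HasPullback e' (pullback.snd e (pullback.fst r.snd s.fst) ≫ pullback.snd r.snd s.fst) :=
    KnopRegular.hasPullback_of_epi _ _
  have h1 := pullback.condition (f := e)
    (g := pullback.fst r.snd s.fst)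
  have h2 := pullback.condition (f := r.snd) (g := s.fst)
  have h3 := pullback.condition (f := e')
    (g := pullback.snd e (pullback.fst r.snd s.fst) ≫ pullback.snd r.snd s.fst)
  refine KnopRegular.hasPullback_of_comm _ _
    (pullback.snd e' (pullback.snd e (pullback.fst r.snd s.fst) ≫ pullback.snd r.snd s.fst) ≫
      pullback.fst _ _)
    (pullback.fst _ _) ?_
  rw [Category.assoc, reassoc_of% h1, h2, reassoc_of% h3]

theorem hom_induction {x y : A} {P : (Relation x y →₀ K) → Prop} (f : Relation x y →₀ K)
    (h0 : P 0) (hadd : ∀ f g, P f → P g → P (f + g))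
    (hs : ∀ (r : RelSpan x y) (a : K), P (a • spanMor δ r.fst r.snd)) : P f := by
  induction f using Finsupp.induction_linear with
  | zero => exact h0
  | add f g hf hg => exact hadd f g hf hg
  | single r a =>
    obtain ⟨r, rfl⟩ := Quotient.exists_rep r
    have := hs r a
    rwa [spanMor_self, Finsupp.smul_single, smul_eq_mul, mul_one] at this

theorem compLin_assoc_span {x y z t : A} (r : RelSpan x y) (s : RelSpan y z) (q : RelSpan z t) :
    compLin δ x z t (compLin δ x y z (spanMor δ r.fst r.snd) (spanMor δ s.fst s.snd))
      (spanMor δ q.fst q.snd) =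
    compLin δ x y t (spanMor δ r.fst r.snd)
      (compLin δ y z t (spanMor δ s.fst s.snd) (spanMor δ q.fst q.snd)) := by
  by_cases h1 : HasPullback r.snd s.fst <;> by_cases h2 : HasPullback s.snd q.fst
  · have S1 := IsPullback.of_hasPullback r.snd s.fst
    have S2 := IsPullback.of_hasPullback s.snd q.fst
    rw [compLin_spanMor δ _ _ _ _ S1, compLin_spanMor δ _ _ _ _ S2]
    by_cases h3 : HasPullback (pullback.snd r.snd s.fst) (pullback.fst s.snd q.fst)
    · have S3 := IsPullback.of_hasPullback (pullback.snd r.snd s.fst) (pullback.fst s.snd q.fst)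
      rw [compLin_spanMor δ _ _ _ _ (S3.flip.paste_horiz S2.flip).flip,
        compLin_spanMor δ _ _ _ _ (S3.paste_horiz S1)]
      simp only [Category.assoc]
    · rw [compLin_spanMor_of_not, compLin_spanMor_of_not]
      · intro h
        exact h3 (KnopRegular.hasPullback_of_comm _ _
          (pullback.lift (pullback.fst r.snd (pullback.fst s.snd q.fst ≫ s.fst))
            (pullback.snd _ _ ≫ pullback.fst _ _) (by simp [pullback.condition]))
          (pullback.snd _ _) (by simp))
      · intro h
        exact h3 (KnopRegular.hasPullback_of_comm _ _
          (pullback.fst (pullback.snd r.snd s.fst ≫ s.snd) q.fst)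
          (pullback.lift (pullback.fst _ _ ≫ pullback.snd _ _) (pullback.snd _ _)
            (by simp [pullback.condition])) (by simp))
  · have S1 := IsPullback.of_hasPullback r.snd s.fst
    rw [compLin_spanMor δ _ _ _ _ S1, compLin_spanMor_of_not δ _ _ _ _ h2, map_zero,
      compLin_spanMor_of_not]
    intro h
    exact h2 (KnopRegular.hasPullback_of_comm _ _
      (pullback.fst (pullback.snd r.snd s.fst ≫ s.snd) q.fst ≫ pullback.snd _ _)
      (pullback.snd _ _) (by simp [pullback.condition]))
  · have S2 := IsPullback.of_hasPullback s.snd q.fst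
    rw [compLin_spanMor δ _ _ _ _ S2, compLin_spanMor_of_not δ _ _ _ _ h1, map_zero,
      LinearMap.zero_apply, compLin_spanMor_of_not]
    intro h
    exact h1 (KnopRegular.hasPullback_of_comm _ _
      (pullback.fst r.snd (pullback.fst s.snd q.fst ≫ s.fst))
      (pullback.snd _ _ ≫ pullback.fst _ _) (by simp [pullback.condition]))
  · rw [compLin_spanMor_of_not δ _ _ _ _ h1, compLin_spanMor_of_not δ _ _ _ _ h2, map_zero,
      map_zero, LinearMap.zero_apply]

theorem compLin_assoc {x y z t : A} (f : Relation x y →₀ K) (g : Relation y z →₀ K)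
    (h : Relation z t →₀ K) :
    compLin δ x z t (compLin δ x y z f g) h = compLin δ x y t f (compLin δ y z t g h) := by
  induction f using hom_induction δ with
  | h0 => simp
  | hadd f f' hf hf' => simp [hf, hf']
  | hs r a =>
    induction g using hom_induction δ with
    | h0 => simp
    | hadd g g' hg hg' => simp only [map_add, LinearMap.add_apply, hg, hg']
    | hs s b =>
      induction h using hom_induction δ with
      | h0 => simp
      | hadd h h' hh hh' => simp only [map_add, hh, hh']
      | hs q c => simp only [map_smul, LinearMap.smul_apply, compLin_assoc_span]

theorem compLin_id_left {x y : A} (f : Relation x y →₀ K) :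
    compLin δ x x y (spanMor δ (𝟙 x) (𝟙 x)) f = f := by
  induction f using hom_induction δ with
  | h0 => simp
  | hadd f f' hf hf' => simp [hf, hf']
  | hs r a =>
    rw [map_smul, compLin_spanMor δ _ _ _ _ (IsPullback.of_vert_isIso ⟨by simp⟩ :
      IsPullback r.fst (𝟙 r.apex) (𝟙 x) r.fst)]
    simp

theorem compLin_id_right {x y : A} (f : Relation x y →₀ K) :
    compLin δ x y y f (spanMor δ (𝟙 y) (𝟙 y)) = f := by
  induction f using hom_induction δ with
  | h0 => simp
  | hadd f f' hf hf' => simp [hf, hf']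
  | hs r a =>
    rw [map_smul, LinearMap.smul_apply, compLin_spanMor δ _ _ _ _ (IsPullback.of_horiz_isIso
      ⟨by simp⟩ : IsPullback (𝟙 r.apex) r.snd r.snd (𝟙 y))]
    simp

end Comp

/-! ### The Deligne–Knop categories -/

section Categories

variable {A : Type u} [Category.{v} A] {K : Type w} [Field K]

/-- The objects `[x]` of the skeletal category `𝒯⁰(A, δ)`. -/
structure T0 (δ : DegreeFunction A K) where
  obj : A

variable [KnopRegular A]

/-- The diagonal relation. -/
def RelSpan.diag (x : A) : RelSpan x x := ⟨x, 𝟙 x, 𝟙 x, fun _ a b h _ => by simpa using h⟩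

/-- The skeletal category `𝒯⁰(A, δ)`: morphisms `[x] ⟶ [y]` are formal `K`-linear combinations of
relations between `x` and `y`, composed bilinearly by `compRel`. -/
instance (δ : DegreeFunction A K) : Category.{max u v w} (T0 δ) where
  Hom X Y := Relation X.obj Y.obj →₀ K
  id X := Finsupp.single (RelSpan.diag X.obj).toRelation 1
  comp {X Y Z} f g := compLin δ X.obj Y.obj Z.obj f g
  id_comp {X Y} f := by
    have := compLin_id_left δ f
    rwa [show spanMor δ (𝟙 X.obj) (𝟙 X.obj) = _ from spanMor_self δ (RelSpan.diag X.obj)] at this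
  comp_id {X Y} f := by
    have := compLin_id_right δ f
    rwa [show spanMor δ (𝟙 Y.obj) (𝟙 Y.obj) = _ from spanMor_self δ (RelSpan.diag Y.obj)] at this
  assoc f g h := compLin_assoc δ f g h

variable (δ : DegreeFunction A K)

instance : Preadditive (T0 δ) where
  homGroup X Y := inferInstanceAs (AddCommGroup (Relation X.obj Y.obj →₀ K))
  add_comp X Y Z f f' g := (compLin δ X.obj Y.obj Z.obj).map_add₂ f f' g
  comp_add X Y Z f g g' := (compLin δ X.obj Y.obj Z.obj f).map_add g g'

instance : Linear K (T0 δ) where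
  homModule X Y := inferInstanceAs (Module K (Relation X.obj Y.obj →₀ K))
  smul_comp X Y Z a f g := (compLin δ X.obj Y.obj Z.obj).map_smul₂ a f g
  comp_smul X Y Z f a g := (compLin δ X.obj Y.obj Z.obj f).map_smul a g

/-- The Deligne–Knop category `𝒯(A, δ)`: the additive Karoubi envelope of `𝒯⁰(A, δ)`. -/
abbrev T := Idempotents.Karoubi (Mat_ (T0 δ))

/-- The canonical embedding `𝒯⁰(A, δ) ⥤ 𝒯(A, δ)`. -/
abbrev embed : T0 δ ⥤ T δ := Mat_.embedding (T0 δ) ⋙ Idempotents.toKaroubi (Mat_ (T0 δ))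

/-- The graph of a morphism, as a relation. -/
def graph {x y : A} (f : x ⟶ y) : RelSpan x y := ⟨x, 𝟙 x, f, fun _ a b h _ => by simpa using h⟩

/-- The embedding `Γ : A ⥤ 𝒯⁰(A, δ)`, which sends a morphism to its graph. -/
def Γ : A ⥤ T0 δ where
  obj x := ⟨x⟩
  map f := Finsupp.single (graph f).toRelation 1
  map_id _ := rfl
  map_comp {x y z} f g := by
    have h : compLin δ x y z (spanMor δ (𝟙 x) f) (spanMor δ (𝟙 y) g) = _ :=
      compLin_spanMor δ _ _ _ _
        (IsPullback.of_horiz_isIso ⟨by simp⟩ : IsPullback (𝟙 x) f f (𝟙 y))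
    rw [show spanMor δ (𝟙 x) f = _ from spanMor_self δ (graph f),
      show spanMor δ (𝟙 y) g = _ from spanMor_self δ (graph g), Category.comp_id,
      show spanMor δ (𝟙 x) (f ≫ g) = _ from spanMor_self δ (graph (f ≫ g))] at h
    exact h.symm

end Categories

/-! ### Functoriality -/

section Functoriality

variable {A : Type u} [Category.{v} A] {A' : Type u'} [Category.{v'} A']

/-- `F` preserves pullbacks: it sends pullback squares to pullback squares, and cospans without a
pullback to cospans without a pullback. (In a regular category pullbacks need not exist; the second
condition is void if all pullbacks exist in `A`.) -/
structure PreservesPullbacks (F : A ⥤ A') : Prop where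
  preserves : PreservesLimitsOfShape WalkingCospan F
  hasPullback {x y z : A} (f : x ⟶ z) (g : y ⟶ z) : HasPullback (F.map f) (F.map g) →
    HasPullback f g

/-- A right adjoint functor out of a regular category preserves pullbacks. -/
theorem PreservesPullbacks.of_adjunction [KnopRegular A] {F : A ⥤ A'} {G : A' ⥤ A} (adj : G ⊣ F) :
    PreservesPullbacks F where
  preserves := (adj.rightAdjoint_preservesLimits : PreservesLimitsOfSize.{0, 0} F).1
  hasPullback f g _ := KnopRegular.hasPullback_of_comm f g
    ((adj.homEquiv _ _).symm (pullback.fst (F.map f) (F.map g)))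
    ((adj.homEquiv _ _).symm (pullback.snd (F.map f) (F.map g))) (by
      rw [← adj.homEquiv_naturality_right_symm, ← adj.homEquiv_naturality_right_symm,
        pullback.condition])

variable {K : Type w} [Field K]

/-- `F` preserves (extremal) epimorphisms and the degree functions. -/
structure PreservesDegree (δ : DegreeFunction A K) (δ' : DegreeFunction A' K) (F : A ⥤ A') :
    Prop where
  map_epi {x y : A} (e : x ⟶ y) [ExtremalEpi e] : ExtremalEpi (F.map e)
  deg_map {x y : A} (e : x ⟶ y) [ExtremalEpi e] [ExtremalEpi (F.map e)] :
    δ'.deg (F.map e) = δ.deg e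

variable [KnopRegular A] [KnopRegular A'] {F : A ⥤ A'}

/-- The relation `F(r)` between `F(x)` and `F(y)`. -/
def PreservesPullbacks.mapSpan (hF : PreservesPullbacks F) {x y : A} (r : RelSpan x y) :
    RelSpan (F.obj x) (F.obj y) where
  apex := F.obj r.apex
  fst := F.map r.fst
  snd := F.map r.snd
  ext _ a b h1 h2 := by
    have := hF.preserves
    have hp : HasPullback (terminal.from x) (terminal.from y) :=
      KnopRegular.hasPullback_of_comm _ _ r.fst r.snd (by subsingleton)
    have S := (IsPullback.of_hasPullback (terminal.from x) (terminal.from y)).map F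
    obtain ⟨m, m1, m2⟩ : ∃ m, m ≫ pullback.fst (terminal.from x) (terminal.from y) = r.fst ∧
        m ≫ pullback.snd (terminal.from x) (terminal.from y) = r.snd :=
      ⟨pullback.lift r.fst r.snd (by subsingleton), by simp, by simp⟩
    have : Mono m := ⟨fun a b h => r.ext a b (by rw [← m1, reassoc_of% h])
      (by rw [← m2, reassoc_of% h])⟩
    rw [← cancel_mono (F.map m)]
    apply S.hom_ext
    · simpa only [Category.assoc, ← F.map_comp, m1] using h1
    · simpa only [Category.assoc, ← F.map_comp, m2] using h2

/-- The map `r ↦ F(r)` on relations. -/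
def PreservesPullbacks.mapRel (hF : PreservesPullbacks F) {x y : A} :
    Relation x y → Relation (F.obj x) (F.obj y) :=
  Quotient.lift (fun r => (hF.mapSpan r).toRelation) (by
    rintro r s ⟨e, h1, h2⟩
    exact RelSpan.toRelation_eq (F.mapIso e)
      ((F.map_comp e.hom s.fst).symm.trans (congrArg F.map h1))
      ((F.map_comp e.hom s.snd).symm.trans (congrArg F.map h2)))

variable {δ : DegreeFunction A K} {δ' : DegreeFunction A' K}

theorem mapDomain_spanMor (hF : PreservesPullbacks F) (hd : PreservesDegree δ δ' F)
    {w x y : A} (p : w ⟶ x) (q : w ⟶ y) :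
    Finsupp.mapDomain hF.mapRel (spanMor δ p q) = spanMor δ' (F.map p) (F.map q) := by
  let e : F.obj w ⟶ (hF.mapSpan (imageSpan p q)).apex := F.map (toImageSpan p q)
  have he : ExtremalEpi (F.map (toImageSpan p q)) := hd.map_epi (toImageSpan p q)
  have he' : ExtremalEpi e := he
  have h1 : e ≫ (hF.mapSpan (imageSpan p q)).fst = F.map p :=
    (F.map_comp _ _).symm.trans (congrArg F.map (toImageSpan_fst p q))
  have h2 : e ≫ (hF.mapSpan (imageSpan p q)).snd = F.map q :=
    (F.map_comp _ _).symm.trans (congrArg F.map (toImageSpan_snd p q))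
  rw [spanMor, Finsupp.mapDomain_single, spanMor_eq δ' _ e h1 h2,
    ← hd.deg_map (toImageSpan p q)]
  rfl

theorem mapDomain_comp (hF : PreservesPullbacks F) (hd : PreservesDegree δ δ' F)
    {x y z : A} (f : Relation x y →₀ K) (g : Relation y z →₀ K) :
    Finsupp.mapDomain hF.mapRel (compLin δ x y z f g) =
      compLin δ' _ _ _ (Finsupp.mapDomain hF.mapRel f) (Finsupp.mapDomain hF.mapRel g) := by
  induction f using hom_induction δ with
  | h0 => simp
  | hadd f f' hf hf' => simp [Finsupp.mapDomain_add, hf, hf']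
  | hs r a =>
    induction g using hom_induction δ with
    | h0 => simp
    | hadd g g' hg hg' => simp only [Finsupp.mapDomain_add, map_add, hg, hg']
    | hs s b =>
      simp only [map_smul, LinearMap.smul_apply, Finsupp.mapDomain_smul, mapDomain_spanMor hF hd]
      congr 2
      by_cases h : HasPullback r.snd s.fst
      · have := hF.preserves
        have S := IsPullback.of_hasPullback r.snd s.fst
        rw [compLin_spanMor δ _ _ _ _ S, compLin_spanMor δ' _ _ _ _ (S.map F),
          mapDomain_spanMor hF hd, F.map_comp, F.map_comp]
      · rw [compLin_spanMor_of_not δ _ _ _ _ h, compLin_spanMor_of_not δ' _ _ _ _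
          (fun h' => h (hF.hasPullback _ _ h')), Finsupp.mapDomain_zero]

/-- The induced functor `F̄ : 𝒯⁰(A, δ) ⥤ 𝒯⁰(A', δ')`, `[x] ↦ [F(x)]`, `⟨r⟩ ↦ ⟨F(r)⟩`. -/
def map0 (hF : PreservesPullbacks F) (hd : PreservesDegree δ δ' F) : T0 δ ⥤ T0 δ' where
  obj X := ⟨F.obj X.obj⟩
  map {X Y} f := Finsupp.mapDomain (hF.mapRel (x := X.obj) (y := Y.obj)) f
  map_id X := by
    refine Finsupp.mapDomain_single.trans (congrArg (Finsupp.single · 1) ?_)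
    exact RelSpan.toRelation_eq (Iso.refl _)
      (by simp [RelSpan.diag, PreservesPullbacks.mapSpan])
      (by simp [RelSpan.diag, PreservesPullbacks.mapSpan])
  map_comp f g := mapDomain_comp hF hd f g

instance (hF : PreservesPullbacks F) (hd : PreservesDegree δ δ' F) : (map0 hF hd).Additive where
  map_add := Finsupp.mapDomain_add

instance (hF : PreservesPullbacks F) (hd : PreservesDegree δ δ' F) : (map0 hF hd).Linear K where
  map_smul f a := Finsupp.mapDomain_smul a f

/-- The extension of an additive functor to the categories of matrices, applied entrywise. -/
def matMap {C : Type*} [Category* C] [Preadditive C] {D : Type*} [Category* D] [Preadditive D]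
    (H : C ⥤ D) [H.Additive] : Mat_ C ⥤ Mat_ D where
  obj M := ⟨M.ι, fun i => H.obj (M.X i)⟩
  map f i j := H.map (f i j)
  map_id M := by
    classical
    ext i j
    by_cases h : i = j
    · subst h; simp
    · simp [h]
  map_comp f g := by
    ext i j
    simp
    rfl

/-- The induced functor `F̄ : 𝒯(A, δ) ⥤ 𝒯(A', δ')`. -/
def map (hF : PreservesPullbacks F) (hd : PreservesDegree δ δ' F) : T δ ⥤ T δ' :=
  (Idempotents.functorExtension₂ (Mat_ (T0 δ)) (Mat_ (T0 δ'))).obj (matMap (map0 hF hd))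

/-- The functor `F̄` on `𝒯(A, δ)` extends the functor `F̄` on `𝒯⁰(A, δ)`. -/
def embedCompMap (hF : PreservesPullbacks F) (hd : PreservesDegree δ δ' F) :
    embed δ ⋙ map hF hd ≅ map0 hF hd ⋙ embed δ' :=
  (Functor.isoWhiskerLeft (Mat_.embedding (T0 δ))
    ((Idempotents.functorExtension₂CompWhiskeringLeftToKaroubiIso
      (Mat_ (T0 δ)) (Mat_ (T0 δ'))).app (matMap (map0 hF hd))) :)

end Functoriality

end DeligneKnop
end

/-!
The whole argument rests on one computation. Composing the graph `Γ(u)` of a morphism `u : x ⟶ z`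
with a span `z ← w → y` amounts to pulling the span back along `u`. For `u = η_{x'}` and the image
`FG(r)` of a relation `x' ← r → y'`, the Cartesian naturality square of `η` at `r ⟶ x'` says that
this pullback is `r` itself, with second leg `r ⟶ FG(r) ⟶ FG(y')`, which by naturality is
`r ⟶ y' ⟶ FG(y')`. Hence the family `Γ(η)` is natural with respect to *all* relations, not only to
graphs, and likewise `Γ(ε)` (`spanHom_comp_Γ_map_eq` is the common form of both statements). The
triangle identities are the images under `Γ` of those of `G ⊣ F`, because `F̄ ∘ Γ = Γ ∘ F`; this
gives `adjunctionT0`.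

The passage from `𝒯⁰` to `𝒯` is formal: an adjunction between additive functors extends to matrices
by applying its hom-set bijection entrywise (`matAdjunction`), and to Karoubi envelopes because the
hom-set bijection is compatible with the idempotents (`karoubiAdjunction`).
-/

namespace DeligneKnop

/-! ### Extending adjunctions to matrices and to Karoubi envelopes -/

section Formal

variable {C : Type*} [Category* C] {D : Type*} [Category* D]

/-- Adjoint functors extend to adjoint functors between the Karoubi envelopes. -/
noncomputable def karoubiAdjunction {L : C ⥤ D} {R : D ⥤ C} (adj : L ⊣ R) :
    (Idempotents.functorExtension₂ C D).obj L ⊣ (Idempotents.functorExtension₂ D C).obj R :=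
  Adjunction.mkOfHomEquiv
    { homEquiv := fun P Q =>
        { toFun := fun f => ⟨adj.homEquiv P.X Q.X f.f, by
            have h : L.map P.p ≫ f.f ≫ Q.p = f.f := f.comm
            exact (congrArg (P.p ≫ ·) (adj.homEquiv_naturality_right f.f Q.p).symm).trans
              ((adj.homEquiv_naturality_left P.p (f.f ≫ Q.p)).symm.trans
                (congrArg (adj.homEquiv P.X Q.X) h))⟩
          invFun := fun g => ⟨(adj.homEquiv P.X Q.X).symm g.f, by
            have h : P.p ≫ g.f ≫ R.map Q.p = g.f := g.comm
            exact (congrArg (L.map P.p ≫ ·) (adj.homEquiv_naturality_right_symm g.f Q.p).symm).trans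
              ((adj.homEquiv_naturality_left_symm P.p (g.f ≫ R.map Q.p)).symm.trans
                (congrArg (adj.homEquiv P.X Q.X).symm h))⟩
          left_inv := fun f => by
            ext; exact (adj.homEquiv P.X Q.X).symm_apply_apply f.f
          right_inv := fun g => by
            ext; exact (adj.homEquiv P.X Q.X).apply_symm_apply g.f }
      homEquiv_naturality_left_symm := fun f g => by
        ext; exact adj.homEquiv_naturality_left_symm f.f g.f
      homEquiv_naturality_right := fun f g => by
        ext; exact adj.homEquiv_naturality_right f.f g.f }

/-- The unit of the extended adjunction at an object of the original category. -/
theorem karoubiAdjunction_unit_toKaroubi_f {L : C ⥤ D} {R : D ⥤ C} (adj : L ⊣ R) (X : C) :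
    ((karoubiAdjunction adj).unit.app ((Idempotents.toKaroubi C).obj X)).f = adj.unit.app X :=
  -- The component is the adjunct of the idempotent `L.map (𝟙 X)`.
  (congrArg (adj.homEquiv X (L.obj X)) (L.map_id X)).trans (adj.homEquiv_id X)

theorem karoubiAdjunction_counit_toKaroubi_f {L : C ⥤ D} {R : D ⥤ C} (adj : L ⊣ R) (Y : D) :
    ((karoubiAdjunction adj).counit.app ((Idempotents.toKaroubi D).obj Y)).f = adj.counit.app Y :=
  (congrArg (adj.homEquiv (R.obj Y) Y).symm (R.map_id Y)).trans (adj.homEquiv_symm_id Y)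

theorem comp_id_comp_map_id (H : C ⥤ D) {X : D} {Y : C} (f : X ⟶ H.obj Y) :
    f ≫ 𝟙 (H.obj Y) ≫ H.map (𝟙 Y) = f := by
  simp

theorem map_id_comp_id_comp (H : C ⥤ D) {X : D} {Y : C} (f : H.obj Y ⟶ X) :
    H.map (𝟙 Y) ≫ 𝟙 (H.obj Y) ≫ f = f := by
  simp

variable [Preadditive C] [Preadditive D]

/-- Adjoint additive functors extend to adjoint functors between the categories of matrices. -/
noncomputable def matAdjunction {L : C ⥤ D} {R : D ⥤ C} [L.Additive] [R.Additive] (adj : L ⊣ R) :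
    matMap L ⊣ matMap R :=
  Adjunction.mkOfHomEquiv
    { homEquiv := fun M N =>
        { toFun := fun f i j => adj.homEquiv (M.X i) (N.X j) (f i j)
          invFun := fun g i j => (adj.homEquiv (M.X i) (N.X j)).symm (g i j)
          left_inv := fun f => by
            ext i j; exact (adj.homEquiv (M.X i) (N.X j)).symm_apply_apply (f i j)
          right_inv := fun g => by
            ext i j; exact (adj.homEquiv (M.X i) (N.X j)).apply_symm_apply (g i j) }
      homEquiv_naturality_left_symm := fun {M' M N} f g => by
        ext i j
        change (adj.homEquiv (M'.X i) (N.X j)).symm (∑ k, f i k ≫ g k j) =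
          ∑ k, L.map (f i k) ≫ (adj.homEquiv (M.X k) (N.X j)).symm (g k j)
        rw [Adjunction.homEquiv_counit, Functor.map_sum, Preadditive.sum_comp]
        refine Finset.sum_congr rfl fun k _ => ?_
        rw [← Adjunction.homEquiv_counit]
        exact adj.homEquiv_naturality_left_symm (f i k) (g k j)
      homEquiv_naturality_right := fun {M N N'} f g => by
        ext i j
        change adj.homEquiv (M.X i) (N'.X j) (∑ k, f i k ≫ g k j) =
          ∑ k, adj.homEquiv (M.X i) (N.X k) (f i k) ≫ R.map (g k j)
        rw [Adjunction.homEquiv_unit, Functor.map_sum, Preadditive.comp_sum]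
        refine Finset.sum_congr rfl fun k _ => ?_
        rw [← Adjunction.homEquiv_unit]
        exact adj.homEquiv_naturality_right (f i k) (g k j) }

/-- The unit of the extended adjunction at a one-entry matrix is the original unit. -/
theorem matAdjunction_unit_embedding {L : C ⥤ D} {R : D ⥤ C} [L.Additive] [R.Additive]
    (adj : L ⊣ R) (x : C) :
    (matAdjunction adj).unit.app ((Mat_.embedding C).obj x) =
      (Mat_.embedding C).map (adj.unit.app x) := by
  refine Mat_.hom_ext _ _ fun i j => ?_
  obtain rfl : i = j := Subsingleton.elim (α := PUnit) i j
  exact (congrArg (adj.homEquiv x (L.obj x))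
    (Mat_.id_apply_self ((Mat_.embedding D).obj (L.obj x)) i)).trans (adj.homEquiv_id x)

theorem matAdjunction_counit_embedding {L : C ⥤ D} {R : D ⥤ C} [L.Additive] [R.Additive]
    (adj : L ⊣ R) (y : D) :
    (matAdjunction adj).counit.app ((Mat_.embedding D).obj y) =
      (Mat_.embedding D).map (adj.counit.app y) := by
  refine Mat_.hom_ext _ _ fun i j => ?_
  obtain rfl : i = j := Subsingleton.elim (α := PUnit) i j
  exact (congrArg (adj.homEquiv (R.obj y) y).symm
    (Mat_.id_apply_self ((Mat_.embedding C).obj (R.obj y)) i)).trans (adj.homEquiv_symm_id y)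

end Formal

/-! ### Relations and graphs -/

section Graphs

variable {A : Type u} [Category.{v} A] [KnopRegular A] {A' : Type u'} [Category.{v'} A']
  [KnopRegular A'] {K : Type w} [Field K]

/-- The morphism `[x] ⟶ [y]` given by a span `x ← w → y`: it is `δ(e) ⟨im⟩`, where `e : w ↠ im` and
`im` is the image of `w → x × y`. The objects are written as values of `Γ`, so that composites with
graphs typecheck without unfolding. -/
noncomputable def spanHom (δ : DegreeFunction A K) {w x y : A} (p : w ⟶ x) (q : w ⟶ y) :
    (Γ δ).obj x ⟶ (Γ δ).obj y :=
  spanMor δ p q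

variable {δ : DegreeFunction A K} {δ' : DegreeFunction A' K}

theorem spanHom_comp {x y z v w t : A} (p : v ⟶ x) (q : v ⟶ y) (p' : w ⟶ y) (q' : w ⟶ z)
    {a : t ⟶ v} {b : t ⟶ w} (h : IsPullback a b q p') :
    spanHom δ p q ≫ spanHom δ p' q' = spanHom δ (a ≫ p) (b ≫ q') :=
  compLin_spanMor δ p q p' q' h

theorem Γ_map_eq {x y : A} (f : x ⟶ y) : (Γ δ).map f = spanHom δ (𝟙 x) f :=
  (spanMor_self δ (graph f)).symm

/-- Composing a graph with a span is pulling the span back along the morphism. -/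
theorem Γ_map_comp_spanHom {x y z w t : A} (u : x ⟶ z) (p : w ⟶ z) (q : w ⟶ y)
    {a : t ⟶ w} {b : t ⟶ x} (h : IsPullback a b p u) :
    (Γ δ).map u ≫ spanHom δ p q = spanHom δ b (a ≫ q) := by
  rw [Γ_map_eq, spanHom_comp _ _ _ _ h.flip, Category.comp_id]

theorem spanHom_comp_Γ_map {x y z w : A} (p : w ⟶ x) (q : w ⟶ y) (u : y ⟶ z) :
    spanHom δ p q ≫ (Γ δ).map u = spanHom δ p (q ≫ u) := by
  rw [Γ_map_eq, spanHom_comp _ _ _ _ (IsPullback.of_horiz_isIso ⟨by simp⟩ :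
    IsPullback (𝟙 w) q q (𝟙 y)), Category.id_comp]

variable {F : A ⥤ A'}

theorem map0_map_spanHom (hF : PreservesPullbacks F) (hd : PreservesDegree δ δ' F)
    {w x y : A} (p : w ⟶ x) (q : w ⟶ y) :
    (map0 hF hd).map (spanHom δ p q) = spanHom δ' (F.map p) (F.map q) :=
  mapDomain_spanMor hF hd p q

theorem map0_map_Γ (hF : PreservesPullbacks F) (hd : PreservesDegree δ δ' F)
    {x y : A} (f : x ⟶ y) :
    (map0 hF hd).map ((Γ δ).map f) = (Γ δ').map (F.map f) := by
  rw [Γ_map_eq, map0_map_spanHom, F.map_id]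
  exact (Γ_map_eq _).symm

/-- For linear functors on `𝒯⁰(A, δ)`, naturality need only be checked on spans, since relations span
the morphisms. -/
theorem naturality_of_spanHom {D : Type*} [Category* D] [Preadditive D] [Linear K D]
    (H H' : T0 δ ⥤ D) [H.Additive] [H'.Additive] [H.Linear K] [H'.Linear K]
    (α : ∀ X : T0 δ, H.obj X ⟶ H'.obj X)
    (h : ∀ {x y w : A} (p : w ⟶ x) (q : w ⟶ y),
      H.map (spanHom δ p q) ≫ α ((Γ δ).obj y) = α ((Γ δ).obj x) ≫ H'.map (spanHom δ p q))
    {X Y : T0 δ} (f : X ⟶ Y) : H.map f ≫ α Y = α X ≫ H'.map f := by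
  let P : (X ⟶ Y) → Prop := fun f => H.map f ≫ α Y = α X ≫ H'.map f
  have h0 : P 0 := by simp [P]
  have hadd : ∀ f g, P f → P g → P (f + g) := fun f g hf hg => by
    simp only [P] at hf hg ⊢
    rw [H.map_add, H'.map_add, Preadditive.add_comp, Preadditive.comp_add, hf, hg]
  have hsmul : ∀ (a : K) f, P f → P (a • f) := fun a f hf => by
    simp only [P] at hf ⊢
    rw [H.map_smul, H'.map_smul, Linear.smul_comp, Linear.comp_smul, hf]
  exact hom_induction δ (P := P) f h0 hadd fun r a => hsmul a _ (h r.fst r.snd)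

end Graphs

/-! ### The induced adjunction -/

section Adjunction

variable {A : Type u} [Category.{v} A] [KnopRegular A] {A' : Type u'} [Category.{v'} A']
  [KnopRegular A'] {K : Type w} [Field K] {δ : DegreeFunction A K} {δ' : DegreeFunction A' K}
  {F : A ⥤ A'} {G : A' ⥤ A}

/-- A span `x ← w → y` and a span `z ← w' → t` are intertwined by the graphs of `u : x ⟶ z` and
`u' : y ⟶ t` as soon as there is `w ⟶ w'` forming a Cartesian square on the first legs and a
commutative square on the second legs. This gives the naturality of both `Γ(η)` and `Γ(ε)`. -/
theorem spanHom_comp_Γ_map_eq {x y z t w w' : A} {p : w ⟶ x} {q : w ⟶ y} {p' : w' ⟶ z}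
    {q' : w' ⟶ t} {u : x ⟶ z} {u' : y ⟶ t} {c : w ⟶ w'} (hp : IsPullback c p p' u)
    (hq : c ≫ q' = q ≫ u') :
    spanHom δ p q ≫ (Γ δ).map u' = (Γ δ).map u ≫ spanHom δ p' q' := by
  rw [spanHom_comp_Γ_map, Γ_map_comp_spanHom _ _ _ hp, hq]

/-- The adjunction `Ḡ ⊣ F̄` on `𝒯⁰`, whose unit and counit are the graphs of `η` and `ε`. -/
noncomputable def adjunctionT0 (adj : G ⊣ F) (hFp : PreservesPullbacks F) (hF : PreservesDegree δ δ' F)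
    (hGp : PreservesPullbacks G) (hG : PreservesDegree δ' δ G)
    (hη : ∀ ⦃x' y' : A'⦄ (f' : x' ⟶ y'),
      IsPullback (adj.unit.app x') f' (F.map (G.map f')) (adj.unit.app y'))
    (hε : ∀ ⦃x y : A⦄ (f : x ⟶ y),
      IsPullback (adj.counit.app x) (G.map (F.map f)) f (adj.counit.app y)) :
    map0 hGp hG ⊣ map0 hFp hF where
  unit :=
    { app := fun X => (Γ δ').map (adj.unit.app X.obj)
      naturality := fun _ _ f => naturality_of_spanHom (𝟭 (T0 δ')) (map0 hGp hG ⋙ map0 hFp hF)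
        (fun X => (Γ δ').map (adj.unit.app X.obj)) (fun p q => by
          have h : (map0 hGp hG ⋙ map0 hFp hF).map (spanHom δ' p q) =
              spanHom δ' (F.map (G.map p)) (F.map (G.map q)) :=
            (congrArg (map0 hFp hF).map (map0_map_spanHom hGp hG p q)).trans
              (map0_map_spanHom hFp hF _ _)
          rw [h]
          exact spanHom_comp_Γ_map_eq (hη p) (hη q).w) f }
  counit :=
    { app := fun X => (Γ δ).map (adj.counit.app X.obj)
      naturality := fun _ _ f => naturality_of_spanHom (map0 hFp hF ⋙ map0 hGp hG) (𝟭 (T0 δ))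
        (fun X => (Γ δ).map (adj.counit.app X.obj)) (fun p q => by
          have h : (map0 hFp hF ⋙ map0 hGp hG).map (spanHom δ p q) =
              spanHom δ (G.map (F.map p)) (G.map (F.map q)) :=
            (congrArg (map0 hGp hG).map (map0_map_spanHom hFp hF p q)).trans
              (map0_map_spanHom hGp hG _ _)
          rw [h]
          exact spanHom_comp_Γ_map_eq (hε p) (hε q).w) f }
  left_triangle_components X :=
    (congrArg (· ≫ _) (map0_map_Γ hGp hG (adj.unit.app X.obj))).trans
      (((Γ δ).map_comp _ _).symm.trans
        ((congrArg (Γ δ).map (adj.left_triangle_components X.obj)).trans ((Γ δ).map_id _)))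
  right_triangle_components X :=
    (congrArg (_ ≫ ·) (map0_map_Γ hFp hF (adj.counit.app X.obj))).trans
      (((Γ δ').map_comp _ _).symm.trans
        ((congrArg (Γ δ').map (adj.right_triangle_components X.obj)).trans ((Γ δ').map_id _)))

end Adjunction

end DeligneKnop

theorem mainTheorem2 {A : Type u} [Category.{v} A] [DeligneKnop.KnopRegular A]
    {A' : Type u'} [Category.{v'} A'] [DeligneKnop.KnopRegular A']
    {K : Type w} [Field K]
    (δ : DeligneKnop.DegreeFunction A K) (δ' : DeligneKnop.DegreeFunction A' K)
    (F : A ⥤ A') (G : A' ⥤ A) (adj : G ⊣ F)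
    (hF : DeligneKnop.PreservesDegree δ δ' F) (hG : DeligneKnop.PreservesDegree δ' δ G)
    (hGp : DeligneKnop.PreservesPullbacks G)
    (hη : ∀ ⦃x' y' : A'⦄ (f' : x' ⟶ y'),
      IsPullback (adj.unit.app x') f' (F.map (G.map f')) (adj.unit.app y'))
    (hε : ∀ ⦃x y : A⦄ (f : x ⟶ y),
      IsPullback (adj.counit.app x) (G.map (F.map f)) f (adj.counit.app y)) :
    (∃ adj₀ : DeligneKnop.map0 hGp hG ⊣
        DeligneKnop.map0 (DeligneKnop.PreservesPullbacks.of_adjunction adj) hF,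
      (∀ x' : A', adj₀.unit.app ((DeligneKnop.Γ δ').obj x') =
        (DeligneKnop.Γ δ').map (adj.unit.app x')) ∧
      (∀ x : A, adj₀.counit.app ((DeligneKnop.Γ δ).obj x) =
        (DeligneKnop.Γ δ).map (adj.counit.app x))) ∧
    (∃ adjT : DeligneKnop.map hGp hG ⊣
        DeligneKnop.map (DeligneKnop.PreservesPullbacks.of_adjunction adj) hF,
      (∀ x' : A', adjT.unit.app ((DeligneKnop.embed δ').obj ((DeligneKnop.Γ δ').obj x')) =
        (DeligneKnop.embed δ').map ((DeligneKnop.Γ δ').map (adj.unit.app x')) ≫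
          (DeligneKnop.embedCompMap (DeligneKnop.PreservesPullbacks.of_adjunction adj) hF).inv.app
            ((DeligneKnop.Γ δ).obj (G.obj x')) ≫
          (DeligneKnop.map (DeligneKnop.PreservesPullbacks.of_adjunction adj) hF).map
            ((DeligneKnop.embedCompMap hGp hG).inv.app ((DeligneKnop.Γ δ').obj x'))) ∧
      (∀ x : A, adjT.counit.app ((DeligneKnop.embed δ).obj ((DeligneKnop.Γ δ).obj x)) =
        (DeligneKnop.map hGp hG).map
            ((DeligneKnop.embedCompMap (DeligneKnop.PreservesPullbacks.of_adjunction adj) hF).hom.app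
              ((DeligneKnop.Γ δ).obj x)) ≫
          (DeligneKnop.embedCompMap hGp hG).hom.app ((DeligneKnop.Γ δ').obj (F.obj x)) ≫
          (DeligneKnop.embed δ).map ((DeligneKnop.Γ δ).map (adj.counit.app x)))) := by
  have hFp := DeligneKnop.PreservesPullbacks.of_adjunction adj
  let adj₀ := DeligneKnop.adjunctionT0 adj hFp hF hGp hG hη hε
  refine ⟨⟨adj₀, fun _ => rfl, fun _ => rfl⟩,
    ⟨DeligneKnop.karoubiAdjunction (DeligneKnop.matAdjunction adj₀), fun x' => ?_, fun x => ?_⟩⟩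
  -- In both cases the components of `embedCompMap` are identity matrices.
  · apply Idempotents.Karoubi.hom_ext
    refine (DeligneKnop.karoubiAdjunction_unit_toKaroubi_f _ _).trans
      ((DeligneKnop.matAdjunction_unit_embedding adj₀ _).trans ?_)
    exact (DeligneKnop.comp_id_comp_map_id (DeligneKnop.matMap (DeligneKnop.map0 hFp hF))
      (Y := (Mat_.embedding _).obj ((DeligneKnop.Γ δ).obj (G.obj x')))
      ((Mat_.embedding _).map ((DeligneKnop.Γ δ').map (adj.unit.app x')))).symm
  · apply Idempotents.Karoubi.hom_ext
    refine (DeligneKnop.karoubiAdjunction_counit_toKaroubi_f _ _).trans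
      ((DeligneKnop.matAdjunction_counit_embedding adj₀ _).trans ?_)
    exact (DeligneKnop.map_id_comp_id_comp (DeligneKnop.matMap (DeligneKnop.map0 hGp hG))
      (Y := (Mat_.embedding _).obj ((DeligneKnop.Γ δ').obj (F.obj x)))
      ((Mat_.embedding _).map ((DeligneKnop.Γ δ).map (adj.counit.app x)))).symm
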